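/- Lemma 4.3. Let $N\in\mathbb N$ and let $\gamma_1,\dots,\gamma_N$ be arcs in $\mathbb R^3$, where $\gamma_i=\phi_i([0,L_i])$, $L_i>0$, and $\phi_i\in C^3([0,L_i];\mathbb R^3)$ is a parametrization by arc length with unit tangent $T_i=d\phi_i/ds_i$, $|T_i|=1$, whose restriction to $]0,L_i[$ is an embedding (an arc may be closed). Assume that the skeleton $S=\bigcup_i\gamma_i$ is connected (and nonempty) and that two different arcs have only finitely many common points. Let $\Gamma_0$ be a nonempty set of ends of arcs, $\Gamma_0\subset\{\phi_i(0),\phi_i(L_i) : 1\le i\le N\}$. Let $H^1(S;\mathbb R^3)$ be the space of families $U=(U_i)_i\in\prod_{i}H^1(0,L_i;\mathbb R^3)$ whose continuous representatives define a single-valued function on $S$, that is, $U_i(s)=U_j(t)$ whenever $\phi_i(s)=\phi_j(t)$, with the usual norm $\|U\|_{H^1(S)}^2=\sum_{i}\int_0^{L_i}\big(|U_i|^2+|dU_i/ds_i|^2\big)ds_i$. Let $H^1_{\Gamma_0}(S;\mathbb R^3)$ be the subspace of those $U$ that vanish on $\Gamma_0$, equipped with the inner product and norm $$\langle U,V\rangle=\sum_{i=1}^N\int_0^{L_i}\frac{dU_i}{ds_i}\cdot\frac{dV_i}{ds_i}\,ds_i,\qquad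 \|U\|_{H^1_{\Gamma_0}}=\langle U,U\rangle^{1/2}.$$ Let $D_I=\{U\in H^1_{\Gamma_0}(S;\mathbb R^3) : \frac{dU_i}{ds_i}\cdot T_i=0 \text{ a.e. on } (0,L_i),\ i=1,\dots,N\}$ be the space of inextensional displacements, let $D_E$ be its orthogonal for $\langle\cdot,\cdot\rangle$ in $H^1_{\Gamma_0}(S;\mathbb R^3)$ (the extensional displacements), and for $U\in D_E$ put $$\|U\|_E=\Big(\sum_{i=1}^N\int_0^{L_i}\Big|\frac{dU_i}{ds_i}\cdot T_i\Big|^2ds_i\Big)^{1/2}.$$ Then $\|\cdot\|_E$ is a norm on $D_E$, and it is equivalent there to the norm of $H^1_{\Gamma_0}(S;\mathbb R^3)$: there are constants $c,C>0$, depending only on the skeleton and on $\Gamma_0$, such that $$c\,\|U\|_{H^1_{\Gamma_0}}\le\|U\|_E\le C\,\|U\|_{H^1_{\Gamma_0}}\qquad\text{for all }U\in D_E,$$ and the same holds, with possibly other constants, with $\|U\|_{H^1(S)}$ in place of $\|U\|_{H^1_{\Gamma_0}}$. -/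

import Mathlib

open MeasureTheory Set
open scoped ContDiff

noncomputable section

namespace RodSkeleton

/-- The Euclidean space `ℝ³`. -/
abbrev E3 : Type := EuclideanSpace ℝ (Fin 3)

/-- The skeleton of a structure made of `N` curved rods: arcs `γ i`, parametrized by arc length by
`φ i` on `[0, L i]`, of class `C³`, embedded on the open interval (so an arc may be closed), whose
union is connected, two different arcs having only finitely many common points. -/
structure Skeleton (N : ℕ) where
  /-- lengths of the arcs -/
  L : Fin N → ℝ
  L_pos : ∀ i, 0 < L i
  /-- arc length parametrizations; only their values on `[0, L i]` matter -/
  φ : Fin N → ℝ → E3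
  contDiffOn : ∀ i, ContDiffOn ℝ 3 (φ i) (Icc 0 (L i))
  arcLength : ∀ i, ∀ s ∈ Icc 0 (L i), ‖derivWithin (φ i) (Icc 0 (L i)) s‖ = 1
  embedded : ∀ i, Topology.IsEmbedding (fun s : Ioo 0 (L i) => φ i s)
  connected : IsConnected (⋃ i, φ i '' Icc 0 (L i))
  finite_inter : ∀ i j, i ≠ j → (φ i '' Icc 0 (L i) ∩ φ j '' Icc 0 (L j)).Finite

/-- Lebesgue measure on `(0, L)`. -/
abbrev intervalMeasure (L : ℝ) : Measure ℝ := volume.restrict (Ioo 0 L)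

/-- `L²(0, L; ℝ³)`. -/
abbrev L2 (L : ℝ) : Type := Lp E3 2 (intervalMeasure L)

/-- `f` is the weak derivative on `(0, L)` of the continuous function `u` on `[0, L]`. -/
def IsWeakDeriv {L : ℝ} (hL : 0 ≤ L) (u : C(Icc 0 L, E3)) (f : L2 L) : Prop :=
  ∀ ψ : ℝ → ℝ, ContDiff ℝ ∞ ψ → HasCompactSupport ψ → tsupport ψ ⊆ Ioo 0 L →
    ∫ s in Ioo 0 L, deriv ψ s • IccExtend hL u s = - ∫ s in Ioo 0 L, ψ s • f s

theorem integrable_smul_of_test {L : ℝ} {χ : ℝ → ℝ} (hc : Continuous χ)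
    (hs : HasCompactSupport χ) {g : ℝ → E3} (hg : Integrable g (intervalMeasure L)) :
    Integrable (fun s => χ s • g s) (intervalMeasure L) := by
  obtain ⟨C, hC⟩ := hs.exists_bound_of_continuous hc
  exact hg.bdd_smul C hc.aestronglyMeasurable (Filter.Eventually.of_forall hC)

theorem integrable_L2 {L : ℝ} (f : L2 L) : Integrable f (intervalMeasure L) :=
  (Lp.memLp f).integrable (by norm_num)

theorem integrable_extend {L : ℝ} (hL : 0 ≤ L) (u : C(Icc 0 L, E3)) :
    Integrable (IccExtend hL u) (intervalMeasure L) :=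
  ((u.continuous.Icc_extend' (h := hL)).continuousOn.integrableOn_Icc
    (a := 0) (b := L)).mono_set Ioo_subset_Icc_self

theorem IsWeakDeriv.add {L : ℝ} {hL : 0 ≤ L} {u v : C(Icc 0 L, E3)} {f g : L2 L}
    (hu : IsWeakDeriv hL u f) (hv : IsWeakDeriv hL v g) : IsWeakDeriv hL (u + v) (f + g) := by
  intro ψ h1 h2 h3
  have hd : Continuous (deriv ψ) := h1.continuous_deriv (by simp)
  have e1 : ∀ s, deriv ψ s • IccExtend hL (u + v : C(Icc 0 L, E3)) s
      = deriv ψ s • IccExtend hL u s + deriv ψ s • IccExtend hL v s := by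
    intro s; simp [IccExtend, smul_add]
  have e2 : (fun s => ψ s • (f + g : L2 L) s)
      =ᵐ[intervalMeasure L] fun s => ψ s • f s + ψ s • g s := by
    filter_upwards [Lp.coeFn_add f g] with s hs
    rw [hs, Pi.add_apply, smul_add]
  simp only [e1]
  rw [integral_congr_ae e2,
    integral_add (integrable_smul_of_test hd h2.deriv (integrable_extend hL u))
      (integrable_smul_of_test hd h2.deriv (integrable_extend hL v)),
    integral_add (integrable_smul_of_test h1.continuous h2 (integrable_L2 f))
      (integrable_smul_of_test h1.continuous h2 (integrable_L2 g)),
    hu ψ h1 h2 h3, hv ψ h1 h2 h3, neg_add]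

theorem IsWeakDeriv.smul {L : ℝ} {hL : 0 ≤ L} {u : C(Icc 0 L, E3)} {f : L2 L} (a : ℝ)
    (hu : IsWeakDeriv hL u f) : IsWeakDeriv hL (a • u) (a • f) := by
  intro ψ h1 h2 h3
  have e1 : ∀ s, deriv ψ s • IccExtend hL (a • u : C(Icc 0 L, E3)) s
      = a • deriv ψ s • IccExtend hL u s := by
    intro s; exact smul_comm (deriv ψ s) a (IccExtend hL u s)
  have e2 : (fun s => ψ s • (a • f : L2 L) s)
      =ᵐ[intervalMeasure L] fun s => a • ψ s • f s := by
    filter_upwards [Lp.coeFn_smul a f] with s hs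
    rw [hs, Pi.smul_apply, smul_comm]
  simp only [e1]
  rw [integral_congr_ae e2, integral_smul, integral_smul, hu ψ h1 h2 h3, smul_neg]

theorem IsWeakDeriv.zero {L : ℝ} {hL : 0 ≤ L} : IsWeakDeriv hL 0 0 := by
  intro ψ _ _ _
  have e2 : (fun s => ψ s • (0 : L2 L) s) =ᵐ[intervalMeasure L] fun _ => (0 : E3) := by
    filter_upwards [Lp.coeFn_zero E3 2 (intervalMeasure L)] with s hs
    rw [hs, Pi.zero_apply, smul_zero]
  rw [integral_congr_ae e2]
  simp [IccExtend]

/-- `H¹(0, L; ℝ³)`. An element is given by its continuous representative on `[0, L]` (so that point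
values make sense) together with its weak derivative in `L²` (which it determines). -/
def H1Interval {L : ℝ} (hL : 0 ≤ L) : Submodule ℝ (C(Icc 0 L, E3) × L2 L) where
  carrier := {p | IsWeakDeriv hL p.1 p.2}
  add_mem' hp hq := IsWeakDeriv.add hp hq
  zero_mem' := IsWeakDeriv.zero
  smul_mem' a _ hp := IsWeakDeriv.smul a hp

namespace Skeleton

variable {N : ℕ} (S : Skeleton N)

/-- The unit tangent `T_i = dφ_i/ds_i`. -/
def tangent (i : Fin N) (s : ℝ) : E3 := derivWithin (S.φ i) (Icc 0 (S.L i)) s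

/-- The set of all ends of arcs. -/
def ends : Set E3 := {x | ∃ i, x = S.φ i 0 ∨ x = S.φ i (S.L i)}

/-- Families of pairs (continuous function on `[0, L i]`, element of `L²(0, L i; ℝ³)`). -/
abbrev Pairs : Type := ∀ i, C(Icc 0 (S.L i), E3) × L2 (S.L i)

/-- The function `U_i` on the arc `i`. -/
abbrev val (U : S.Pairs) (i : Fin N) : C(Icc 0 (S.L i), E3) := (U i).1

/-- The derivative `dU_i/ds_i`. -/
abbrev der (U : S.Pairs) (i : Fin N) : L2 (S.L i) := (U i).2

/-- `H¹(S; ℝ³)`: families of `H¹` functions on the arcs that define a single-valued function on the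
skeleton. -/
def H1 : Submodule ℝ S.Pairs where
  carrier := {U | (∀ i, U i ∈ H1Interval (S.L_pos i).le) ∧
    ∀ i j (s : Icc 0 (S.L i)) (t : Icc 0 (S.L j)), S.φ i s = S.φ j t → S.val U i s = S.val U j t}
  add_mem' := by
    rintro U V ⟨hU, hU'⟩ ⟨hV, hV'⟩
    refine ⟨fun i => Submodule.add_mem _ (hU i) (hV i), fun i j s t h => ?_⟩
    exact congrArg₂ (· + ·) (hU' i j s t h) (hV' i j s t h)
  zero_mem' := ⟨fun i => Submodule.zero_mem _, fun _ _ _ _ _ => rfl⟩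
  smul_mem' := by
    rintro a U ⟨hU, hU'⟩
    refine ⟨fun i => Submodule.smul_mem _ a (hU i), fun i j s t h => ?_⟩
    exact congrArg (a • ·) (hU' i j s t h)

/-- `H¹_{Γ₀}(S; ℝ³)`: the elements of `H¹(S; ℝ³)` that vanish on `Γ₀`. -/
def H1Clamped (Γ₀ : Set E3) : Submodule ℝ S.Pairs where
  carrier := {U | U ∈ S.H1 ∧ ∀ i (s : Icc 0 (S.L i)), S.φ i s ∈ Γ₀ → S.val U i s = 0}
  add_mem' := by
    rintro U V ⟨hU, hU'⟩ ⟨hV, hV'⟩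
    refine ⟨Submodule.add_mem _ hU hV, fun i s h => ?_⟩
    exact (congrArg₂ (· + ·) (hU' i s h) (hV' i s h)).trans (add_zero 0)
  zero_mem' := ⟨Submodule.zero_mem _, fun _ _ _ => rfl⟩
  smul_mem' := by
    rintro a U ⟨hU, hU'⟩
    refine ⟨Submodule.smul_mem _ a hU, fun i s h => ?_⟩
    exact (congrArg (a • ·) (hU' i s h)).trans (smul_zero a)

/-- `⟨U, V⟩ = ∑ i, ∫ dU_i/ds_i · dV_i/ds_i` over `(0, L i)`, the inner product of
`H¹_{Γ₀}(S; ℝ³)`. -/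
def ip (U V : S.Pairs) : ℝ :=
  ∑ i, ∫ s in Ioo 0 (S.L i), inner ℝ (S.der U i s) (S.der V i s)

theorem ip_eq (U V : S.Pairs) : S.ip U V = ∑ i, inner ℝ (S.der U i) (S.der V i) := rfl

theorem ip_zero_left (W : S.Pairs) : S.ip 0 W = 0 :=
  (S.ip_eq 0 W).trans (Finset.sum_eq_zero fun i _ => inner_zero_left (S.der W i))

theorem ip_add_left (U V W : S.Pairs) : S.ip (U + V) W = S.ip U W + S.ip V W := by
  rw [ip_eq, ip_eq, ip_eq, ← Finset.sum_add_distrib]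
  exact Finset.sum_congr rfl fun i _ => inner_add_left (S.der U i) (S.der V i) (S.der W i)

theorem ip_smul_left (a : ℝ) (U W : S.Pairs) : S.ip (a • U) W = a * S.ip U W := by
  rw [ip_eq, ip_eq, Finset.mul_sum]
  exact Finset.sum_congr rfl fun i _ => real_inner_smul_left (S.der U i) (S.der W i) a

/-- The norm of `H¹_{Γ₀}(S; ℝ³)` induced by its inner product. -/
def clampedNorm (U : S.Pairs) : ℝ := √(S.ip U U)

/-- The usual norm of `H¹(S; ℝ³)`. -/
def h1Norm (U : S.Pairs) : ℝ :=
  √(∑ i, ∫ s in Ioo 0 (S.L i),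
    (‖IccExtend (S.L_pos i).le (S.val U i) s‖ ^ 2 + ‖S.der U i s‖ ^ 2))

/-- The inextensional displacements: `dU_i/ds_i · T_i = 0` for all `i`. -/
def DI (Γ₀ : Set E3) : Set S.Pairs :=
  {U | U ∈ S.H1Clamped Γ₀ ∧
    ∀ i, ∀ᵐ s ∂(intervalMeasure (S.L i)), inner ℝ (S.der U i s) (S.tangent i s) = 0}

/-- The extensional displacements: the orthogonal of `DI` in `H¹_{Γ₀}(S; ℝ³)`. -/
def DE (Γ₀ : Set E3) : Submodule ℝ S.Pairs where
  carrier := {U | U ∈ S.H1Clamped Γ₀ ∧ ∀ V ∈ S.DI Γ₀, S.ip U V = 0}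
  add_mem' := by
    rintro U V ⟨hU, hU'⟩ ⟨hV, hV'⟩
    refine ⟨Submodule.add_mem _ hU hV, fun W hW => ?_⟩
    rw [ip_add_left, hU' W hW, hV' W hW, add_zero]
  zero_mem' := ⟨Submodule.zero_mem _, fun W _ => S.ip_zero_left W⟩
  smul_mem' := by
    rintro a U ⟨hU, hU'⟩
    refine ⟨Submodule.smul_mem _ a hU, fun W hW => ?_⟩
    rw [ip_smul_left, hU' W hW, mul_zero]

/-- The seminorm `‖U‖_E = (∑ i, ∫ |dU_i/ds_i · T_i|²)^{1/2}`. -/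
def normE (U : S.Pairs) : ℝ :=
  √(∑ i, ∫ s in Ioo 0 (S.L i), |inner ℝ (S.der U i s) (S.tangent i s)| ^ 2)

end Skeleton

end RodSkeleton

end

/-!
The estimate `‖U‖_E ≤ ‖U‖` is Cauchy-Schwarz. The converse on the extensional displacements rests on
a bounded lifting (`exists_bounded_lift`): for every displacement `U` there is a displacement `V`
with the same tangential derivative `dV_i/ds_i · T_i = dU_i/ds_i · T_i` and `‖V‖ ≤ K ‖U‖_E`. Then
`U - V` is inextensional, so for extensional `U` one gets `‖U‖² = ⟨U, V⟩ ≤ ‖U‖ ‖V‖`, that is,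
`‖U‖ ≤ K ‖U‖_E`. Neither completeness nor an orthogonal decomposition is needed.

To build `V`, put `g_i = (dU_i/ds_i · T_i) T_i`. The primitives `s ↦ ∫₀ˢ g_i` have the right
tangential derivative and `H¹` seminorm `‖U‖_E`. They define a displacement of the skeleton as soon
as they vanish at the nodes, that is, at the ends of arcs and the common points of different arcs
(`exists_deriv_eq`). The nodes have finitely many parameters, because the arcs are injective on the
open intervals, so vanishing there amounts to finitely many linear conditions, whose defect is
bounded by `‖U‖_E`. The defect is removed by subtracting a displacement chosen linearly in it, and
linear maps on finite-dimensional spaces are bounded (`exists_apply_eq_norm_le`).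

The usual norm of `H¹(S; ℝ³)` is compared with that of `H¹_{Γ₀}(S; ℝ³)` by the Poincaré inequality
(`exists_norm_val_le`, `exists_h1Norm_le`), where the connectedness of the skeleton and
`Γ₀ ≠ ∅` enter. Both parts use the fundamental theorem of calculus for weak derivatives
(`isWeakDeriv_primitive`, `IsWeakDeriv.eq_add_primitive`).
-/

namespace RodSkeleton

/-! ### The weak derivative on an interval -/

/-- Integration by parts for the primitive of an integrable function, by Fubini's theorem. -/
theorem integral_deriv_smul_primitive {L : ℝ} {f : ℝ → E3}
    (hf : Integrable f (intervalMeasure L)) {ψ : ℝ → ℝ} (h1 : ContDiff ℝ ∞ ψ)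
    (h2 : HasCompactSupport ψ) (h3 : tsupport ψ ⊆ Ioo 0 L) :
    ∫ s in Ioo 0 L, deriv ψ s • ∫ r in (0 : ℝ)..s, f r = - ∫ s in Ioo 0 L, ψ s • f s := by
  have hd : Continuous (deriv ψ) := h1.continuous_deriv (by simp)
  have hψL : ψ L = 0 := image_eq_zero_of_notMem_tsupport fun h => lt_irrefl _ (h3 h).2
  have hint : Integrable (deriv ψ) (intervalMeasure L) :=
    (hd.integrable_of_hasCompactSupport h2.deriv).restrict
  have hm : MeasurableSet {p : ℝ × ℝ | p.2 < p.1} := measurableSet_lt measurable_snd measurable_fst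
  have hF : Integrable (Function.uncurry fun s r : ℝ =>
      ({p : ℝ × ℝ | p.2 < p.1}).indicator (fun p => deriv ψ p.1 • f p.2) (s, r))
      ((intervalMeasure L).prod (intervalMeasure L)) :=
    (hint.smul_prod hf).indicator hm
  have key := integral_integral_swap hF
  have e1 : ∫ s in Ioo 0 L, deriv ψ s • ∫ r in (0 : ℝ)..s, f r =
      ∫ s in Ioo 0 L, ∫ r in Ioo 0 L,
        ({p : ℝ × ℝ | p.2 < p.1}).indicator (fun p => deriv ψ p.1 • f p.2) (s, r) := by
    refine setIntegral_congr_fun measurableSet_Ioo fun s hs => ?_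
    have : (fun r => ({p : ℝ × ℝ | p.2 < p.1}).indicator (fun p => deriv ψ p.1 • f p.2) (s, r))
        = (Iio s).indicator (fun r => deriv ψ s • f r) := by
      ext1 r; by_cases h : r < s <;> simp [indicator, h]
    simp only [this]
    rw [setIntegral_indicator measurableSet_Iio, integral_smul,
      intervalIntegral.integral_of_le hs.1.le, integral_Ioc_eq_integral_Ioo, Ioo_inter_Iio,
      min_eq_right hs.2.le]
  have e2 : ∫ r in Ioo 0 L, ∫ s in Ioo 0 L,
        ({p : ℝ × ℝ | p.2 < p.1}).indicator (fun p => deriv ψ p.1 • f p.2) (s, r)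
      = ∫ r in Ioo 0 L, -(ψ r • f r) := by
    refine setIntegral_congr_fun measurableSet_Ioo fun r hr => ?_
    have : (fun s => ({p : ℝ × ℝ | p.2 < p.1}).indicator (fun p => deriv ψ p.1 • f p.2) (s, r))
        = (Ioi r).indicator (fun s => deriv ψ s • f r) := by
      ext1 s; by_cases h : r < s <;> simp [indicator, h]
    simp only [this]
    rw [setIntegral_indicator measurableSet_Ioi, Ioo_inter_Ioi, max_eq_right hr.1.le,
      integral_smul_const, ← integral_Ioc_eq_integral_Ioo,
      ← intervalIntegral.integral_of_le hr.2.le,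
      intervalIntegral.integral_deriv_eq_sub (fun x _ => (h1.differentiable (by simp)) x)
        (hd.intervalIntegrable _ _), hψL, zero_sub, neg_smul]
  rw [e1, key, e2, integral_neg]

/-- **Du Bois-Reymond lemma**: a continuous function with zero weak derivative is constant. -/
theorem exists_eq_const_of_integral_deriv_smul_eq_zero {L : ℝ} (hL : 0 < L) {w : ℝ → E3}
    (hw : Continuous w)
    (h : ∀ ψ : ℝ → ℝ, ContDiff ℝ ∞ ψ → HasCompactSupport ψ → tsupport ψ ⊆ Ioo 0 L →
      ∫ s in Ioo 0 L, deriv ψ s • w s = 0) :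
    ∃ c : E3, ∀ s ∈ Icc 0 L, w s = c := by
  -- a test function of integral one
  obtain ⟨θ, hθ, hθc, hθs, hθ1⟩ : ∃ θ : ℝ → ℝ, ContDiff ℝ ∞ θ ∧ HasCompactSupport θ ∧
      tsupport θ ⊆ Ioo 0 L ∧ ∫ s in Ioo 0 L, θ s = 1 := by
    let b : ContDiffBump (L / 2) := ⟨L / 8, L / 4, by positivity, by linarith⟩
    have hs : tsupport (b.normed volume) ⊆ Ioo 0 L := by
      rw [b.tsupport_normed_eq, Real.closedBall_eq_Icc]
      intro x hx
      have h1 := hx.1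
      have h2 := hx.2
      constructor <;> · simp only [b] at h1 h2; linarith
    refine ⟨b.normed volume, b.contDiff_normed, b.hasCompactSupport_normed, hs, ?_⟩
    rw [setIntegral_eq_integral_of_forall_compl_eq_zero, b.integral_normed]
    exact fun x hx => image_eq_zero_of_notMem_tsupport fun h => hx (hs h)
  have hint : ∀ {η : ℝ → ℝ}, Continuous η → HasCompactSupport η →
      Integrable (fun s => η s • w s) (intervalMeasure L) := fun h1 h2 =>
    ((h1.smul hw).integrable_of_hasCompactSupport h2.smul_right).restrict
  refine ⟨∫ s in Ioo 0 L, θ s • w s, ?_⟩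
  set c := ∫ s in Ioo 0 L, θ s • w s
  have key : ∀ η : ℝ → ℝ, ContDiff ℝ ∞ η → HasCompactSupport η → tsupport η ⊆ Ioo 0 L →
      ∫ s, η s • (w s - c) = 0 := by
    intro η h1 h2 h3
    -- `η` minus a multiple of `θ` has integral zero, so it is the derivative of a test function
    set m := ∫ s in Ioo 0 L, η s with hm
    set ζ : ℝ → ℝ := fun s => η s - m * θ s with hζ
    have hζd : ContDiff ℝ ∞ ζ := h1.sub (contDiff_const.mul hθ)
    have hζi : ∫ s in Ioo 0 L, ζ s = 0 := by
      rw [hζ, integral_sub, integral_const_mul, hθ1, mul_one, sub_self]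
      · exact (h1.continuous.integrable_of_hasCompactSupport h2).restrict
      · exact ((hθ.continuous.integrable_of_hasCompactSupport hθc).restrict).const_mul m
    have hK : IsCompact (tsupport η ∪ tsupport θ) := h2.isCompact.union hθc.isCompact
    obtain ⟨a, b, ha, hb, hsub⟩ : ∃ a b, 0 < a ∧ b < L ∧
        tsupport η ∪ tsupport θ ⊆ Icc a b := by
      have hne : (tsupport η ∪ tsupport θ).Nonempty := by
        by_contra hne
        rw [not_nonempty_iff_eq_empty, union_empty_iff] at hne
        have : θ = 0 := tsupport_eq_empty_iff.1 hne.2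
        simp [this] at hθ1
      have hs := union_subset h3 hθs
      obtain ⟨a, ha⟩ := hK.exists_isLeast hne
      obtain ⟨b, hb⟩ := hK.exists_isGreatest hne
      exact ⟨a, b, (hs ha.1).1, (hs hb.1).2, fun x hx => ⟨ha.2 hx, hb.2 hx⟩⟩
    have hζ0 : ∀ s, s ∉ Icc a b → ζ s = 0 := by
      intro s hs
      have e1 : η s = 0 := image_eq_zero_of_notMem_tsupport fun h => hs (hsub (Or.inl h))
      have e2 : θ s = 0 := image_eq_zero_of_notMem_tsupport fun h => hs (hsub (Or.inr h))
      simp [hζ, e1, e2]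
    have hder : ∀ s, HasDerivAt (fun s => ∫ r in (0 : ℝ)..s, ζ r) (ζ s) s := fun s =>
      (hζd.continuous.integral_hasStrictDerivAt 0 s).hasDerivAt
    have hderiv : deriv (fun s => ∫ r in (0 : ℝ)..s, ζ r) = ζ := funext fun s => (hder s).deriv
    have hzero : ∀ s, s ∉ Icc a b → ∫ r in (0 : ℝ)..s, ζ r = 0 := by
      intro s hs
      rcases lt_or_ge s a with h | h
      · apply intervalIntegral.integral_zero_ae
        refine Filter.Eventually.of_forall fun r hr => hζ0 r fun hr' => ?_
        have := hr'.1
        rcases le_max_iff.1 hr.2 with h' | h' <;> linarith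
      · have hbs : b < s := by
          by_contra hbs
          exact hs ⟨h, not_lt.1 hbs⟩
        have e1 : ∫ r in s..L, ζ r = 0 := by
          apply intervalIntegral.integral_zero_ae
          refine Filter.Eventually.of_forall fun r hr => hζ0 r fun hr' => ?_
          have h' : min s L < r := hr.1
          have := hr'.2
          rcases min_lt_iff.1 h' with h' | h' <;> linarith
        have e2 : ∫ r in (0 : ℝ)..L, ζ r = 0 := by
          rw [intervalIntegral.integral_of_le hL.le, integral_Ioc_eq_integral_Ioo, hζi]
        have := intervalIntegral.integral_add_adjacent_intervals
          (hζd.continuous.intervalIntegrable (μ := volume) 0 s)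
          (hζd.continuous.intervalIntegrable s L)
        rwa [e1, e2, add_zero] at this
    have hts : tsupport (fun s => ∫ r in (0 : ℝ)..s, ζ r) ⊆ Icc a b :=
      closure_minimal (fun s hs => by_contra fun h => hs (hzero s h)) isClosed_Icc
    have h0 := h (fun s => ∫ r in (0 : ℝ)..s, ζ r)
      (contDiff_infty_iff_deriv.2 ⟨fun s => (hder s).differentiableAt, by rwa [hderiv]⟩)
      (HasCompactSupport.of_support_subset_isCompact isCompact_Icc
        ((subset_tsupport _).trans hts))
      (hts.trans (Icc_subset_Ioo ha hb))
    rw [hderiv] at h0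
    have e3 : ∫ s in Ioo 0 L, ζ s • w s = (∫ s in Ioo 0 L, η s • w s) - m • c := by
      have : ∀ s, ζ s • w s = η s • w s - m • θ s • w s := fun s => by
        simp only [hζ, sub_smul, mul_smul]
      simp only [this]
      rw [integral_sub (hint h1.continuous h2) (g := fun s => m • θ s • w s)
        ((hint hθ.continuous hθc).smul m), integral_smul]
    have e4 : ∫ s, η s • (w s - c) = ∫ s in Ioo 0 L, η s • (w s - c) := by
      rw [setIntegral_eq_integral_of_forall_compl_eq_zero]
      intro x hx
      rw [image_eq_zero_of_notMem_tsupport fun h => hx (h3 h), zero_smul]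
    rw [e4]
    simp only [smul_sub]
    rw [integral_sub (hint h1.continuous h2), integral_smul_const, ← hm, ← e3, h0]
    exact ((h1.continuous.integrable_of_hasCompactSupport h2).restrict).smul_const c
  have hae := isOpen_Ioo.ae_eq_zero_of_integral_contDiff_smul_eq_zero (μ := volume)
    (f := fun s => w s - c) ((hw.sub continuous_const).locallyIntegrable.locallyIntegrableOn _) key
  have hIoo : EqOn w (fun _ => c) (Ioo 0 L) := by
    refine Measure.eqOn_open_of_ae_eq (μ := volume) ?_ isOpen_Ioo hw.continuousOn continuousOn_const
    rw [Filter.EventuallyEq, ae_restrict_iff' measurableSet_Ioo]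
    filter_upwards [hae] with s hs hs'
    exact sub_eq_zero.1 (hs hs')
  intro s hs
  have := hIoo.closure hw continuous_const
  rw [closure_Ioo hL.ne] at this
  exact this hs

theorem intervalIntegrable_L2 {L : ℝ} (f : L2 L) {a b : ℝ} (ha : a ∈ Icc 0 L) (hb : b ∈ Icc 0 L) :
    IntervalIntegrable f volume a b := by
  rw [intervalIntegrable_iff]
  have : IntegrableOn f (Icc 0 L) :=
    (integrableOn_Icc_iff_integrableOn_Ioo (by simp) (by simp)).2 (integrable_L2 f)
  exact this.mono_set (uIoc_subset_uIcc.trans (uIcc_subset_Icc ha hb))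

theorem continuous_integral_L2 {L : ℝ} (hL : 0 ≤ L) (f : L2 L) :
    Continuous fun s : Icc 0 L => ∫ r in (0 : ℝ)..s, f r := by
  have := intervalIntegral.continuousOn_primitive_interval'
    (intervalIntegrable_L2 f (left_mem_Icc.2 hL) (right_mem_Icc.2 hL)) left_mem_uIcc
  rw [uIcc_of_le hL] at this
  exact this.comp_continuous continuous_subtype_val fun s => s.2

/-- The primitive, vanishing at `0`, of an element of `L²(0, L; ℝ³)`. -/
noncomputable def primitive {L : ℝ} (hL : 0 ≤ L) : L2 L →ₗ[ℝ] C(Icc 0 L, E3) where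
  toFun f := ⟨fun s => ∫ r in (0 : ℝ)..s, f r, continuous_integral_L2 hL f⟩
  map_add' f g := by
    ext1 s
    change ∫ r in (0 : ℝ)..s, (f + g : L2 L) r
      = (∫ r in (0 : ℝ)..s, f r) + ∫ r in (0 : ℝ)..s, g r
    rw [← intervalIntegral.integral_add (intervalIntegrable_L2 f (left_mem_Icc.2 hL) s.2)
      (intervalIntegrable_L2 g (left_mem_Icc.2 hL) s.2),
      intervalIntegral.integral_of_le s.2.1, intervalIntegral.integral_of_le s.2.1,
      integral_Ioc_eq_integral_Ioo, integral_Ioc_eq_integral_Ioo]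
    exact integral_congr_ae
      (ae_restrict_of_ae_restrict_of_subset (Ioo_subset_Ioo_right s.2.2) (Lp.coeFn_add f g))
  map_smul' a f := by
    ext1 s
    change ∫ r in (0 : ℝ)..s, (a • f : L2 L) r = a • ∫ r in (0 : ℝ)..s, f r
    rw [← intervalIntegral.integral_smul,
      intervalIntegral.integral_of_le s.2.1, intervalIntegral.integral_of_le s.2.1,
      integral_Ioc_eq_integral_Ioo, integral_Ioc_eq_integral_Ioo]
    exact integral_congr_ae
      (ae_restrict_of_ae_restrict_of_subset (Ioo_subset_Ioo_right s.2.2) (Lp.coeFn_smul a f))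

theorem primitive_apply {L : ℝ} (hL : 0 ≤ L) (f : L2 L) (s : Icc 0 L) :
    primitive hL f s = ∫ r in (0 : ℝ)..s, f r := rfl

theorem isWeakDeriv_primitive {L : ℝ} (hL : 0 ≤ L) (f : L2 L) :
    IsWeakDeriv hL (primitive hL f) f := by
  intro ψ h1 h2 h3
  rw [← integral_deriv_smul_primitive (integrable_L2 f) h1 h2 h3]
  refine setIntegral_congr_fun measurableSet_Ioo fun s hs => ?_
  simp only [IccExtend_of_mem hL _ (Ioo_subset_Icc_self hs), primitive_apply]

/-- The fundamental theorem of calculus in `H¹(0, L; ℝ³)`. -/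
theorem IsWeakDeriv.eq_add_primitive {L : ℝ} (hL : 0 < L) {u : C(Icc 0 L, E3)} {f : L2 L}
    (h : IsWeakDeriv hL.le u f) (s : Icc 0 L) :
    u s = u ⟨0, left_mem_Icc.2 hL.le⟩ + primitive hL.le f s := by
  have h0 : IsWeakDeriv hL.le (u + (-1 : ℝ) • primitive hL.le f) (f + (-1 : ℝ) • f) :=
    h.add ((isWeakDeriv_primitive hL.le f).smul (-1))
  rw [show f + (-1 : ℝ) • f = 0 by rw [neg_one_smul, add_neg_cancel]] at h0
  obtain ⟨c, hc⟩ := exists_eq_const_of_integral_deriv_smul_eq_zero hL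
    (w := IccExtend hL.le (u + (-1 : ℝ) • primitive hL.le f : C(Icc 0 L, E3)))
    ((ContinuousMap.continuous _).Icc_extend') (by
      intro ψ h1 h2 h3
      rw [h0 ψ h1 h2 h3, neg_eq_zero]
      refine (integral_congr_ae ?_).trans (integral_zero _ _)
      filter_upwards [Lp.coeFn_zero E3 2 (intervalMeasure L)] with s hs
      rw [hs, Pi.zero_apply, smul_zero])
  have e0 := hc 0 (left_mem_Icc.2 hL.le)
  have es := hc s s.2
  rw [IccExtend_of_mem hL.le _ (left_mem_Icc.2 hL.le)] at e0
  rw [IccExtend_of_mem hL.le _ s.2] at es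
  have hp : primitive hL.le f ⟨0, left_mem_Icc.2 hL.le⟩ = 0 := by simp [primitive_apply]
  simp only [ContinuousMap.add_apply, ContinuousMap.smul_apply, hp, smul_zero, add_zero] at e0 es
  rw [e0, ← es]
  simp

theorem norm_primitive_le {L : ℝ} (hL : 0 ≤ L) (f : L2 L) (s : Icc 0 L) :
    ‖primitive hL f s‖ ≤ √L * ‖f‖ := by
  have h1 : ‖primitive hL f s‖ ≤ ∫ r in Ioo 0 L, ‖f r‖ := by
    rw [primitive_apply, intervalIntegral.integral_of_le s.2.1, integral_Ioc_eq_integral_Ioo]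
    refine (norm_integral_le_integral_norm _).trans ?_
    exact setIntegral_mono_set (integrable_L2 f).norm
      (Filter.Eventually.of_forall fun _ => norm_nonneg _)
      (Ioo_subset_Ioo_right s.2.2).eventuallyLE
  refine h1.trans ?_
  rw [integral_norm_eq_lintegral_enorm (Lp.aestronglyMeasurable f), ← eLpNorm_one_eq_lintegral_enorm,
    Lp.norm_def, mul_comm]
  have h2 := eLpNorm_le_eLpNorm_mul_rpow_measure_univ (p := 1) (q := 2) (by norm_num)
    (Lp.aestronglyMeasurable f)
  have h3 : ((intervalMeasure L) univ) ^ (1 / (1 : ENNReal).toReal - 1 / (2 : ENNReal).toReal)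
      = ENNReal.ofReal (√L) := by
    rw [Measure.restrict_apply_univ, Real.volume_Ioo, sub_zero,
      ENNReal.ofReal_rpow_of_nonneg hL (by norm_num), Real.sqrt_eq_rpow]
    norm_num
  rw [h3] at h2
  have h4 := ENNReal.toReal_mono
    (ENNReal.mul_ne_top (Lp.eLpNorm_ne_top f) ENNReal.ofReal_ne_top) h2
  rwa [ENNReal.toReal_mul, ENNReal.toReal_ofReal (Real.sqrt_nonneg _)] at h4

namespace Skeleton

variable {N : ℕ} (S : Skeleton N)

/-! ### Tangential components -/

theorem aestronglyMeasurable_tangent (i : Fin N) :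
    AEStronglyMeasurable (S.tangent i) (intervalMeasure (S.L i)) :=
  (((S.contDiffOn i).continuousOn_derivWithin (uniqueDiffOn_Icc (S.L_pos i)) (by norm_num)).mono
    Ioo_subset_Icc_self).aestronglyMeasurable measurableSet_Ioo

theorem ae_norm_tangent (i : Fin N) :
    ∀ᵐ s ∂(intervalMeasure (S.L i)), ‖S.tangent i s‖ = 1 := by
  rw [ae_restrict_iff' measurableSet_Ioo]
  exact Filter.Eventually.of_forall fun s hs => S.arcLength i s (Ioo_subset_Icc_self hs)

theorem memLp_tangential (i : Fin N) (f : L2 (S.L i)) :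
    MemLp (fun s => (inner ℝ (f s) (S.tangent i s) : ℝ) • S.tangent i s) 2
      (intervalMeasure (S.L i)) := by
  have hm : AEStronglyMeasurable (fun s => (inner ℝ (f s) (S.tangent i s) : ℝ))
      (intervalMeasure (S.L i)) :=
    (Lp.aestronglyMeasurable f).inner (S.aestronglyMeasurable_tangent i)
  refine (Lp.memLp f).of_le (hm.smul (S.aestronglyMeasurable_tangent i)) ?_
  filter_upwards [S.ae_norm_tangent i] with s hs
  have := norm_inner_le_norm (𝕜 := ℝ) (f s) (S.tangent i s)
  rw [hs, mul_one] at this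
  rwa [norm_smul, hs, mul_one]

/-- The pointwise orthogonal projection `f ↦ (f · T_i) T_i` of `L²(0, L i; ℝ³)` onto the
tangential fields of the arc `i`. -/
noncomputable def tangential (i : Fin N) : L2 (S.L i) →ₗ[ℝ] L2 (S.L i) where
  toFun f := (S.memLp_tangential i f).toLp
  map_add' f g := by
    ext1
    filter_upwards [(S.memLp_tangential i f).coeFn_toLp, (S.memLp_tangential i g).coeFn_toLp,
      (S.memLp_tangential i (f + g)).coeFn_toLp, Lp.coeFn_add f g,
      Lp.coeFn_add (S.memLp_tangential i f).toLp (S.memLp_tangential i g).toLp]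
      with s h1 h2 h3 h4 h5
    rw [h3, h5, Pi.add_apply, h1, h2, h4, Pi.add_apply, inner_add_left, add_smul]
  map_smul' a f := by
    ext1
    filter_upwards [(S.memLp_tangential i f).coeFn_toLp,
      (S.memLp_tangential i (a • f)).coeFn_toLp, Lp.coeFn_smul a f,
      Lp.coeFn_smul a (S.memLp_tangential i f).toLp] with s h1 h2 h3 h4
    rw [h2, RingHom.id_apply, h4, Pi.smul_apply, h1, h3, Pi.smul_apply, real_inner_smul_left,
      mul_smul]

theorem coeFn_tangential (i : Fin N) (f : L2 (S.L i)) :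
    S.tangential i f =ᵐ[intervalMeasure (S.L i)]
      fun s => (inner ℝ (f s) (S.tangent i s) : ℝ) • S.tangent i s :=
  (S.memLp_tangential i f).coeFn_toLp

theorem norm_tangential_le (i : Fin N) (f : L2 (S.L i)) : ‖S.tangential i f‖ ≤ ‖f‖ := by
  refine Lp.norm_le_norm_of_ae_le ?_
  filter_upwards [S.coeFn_tangential i f, S.ae_norm_tangent i] with s h hs
  have := norm_inner_le_norm (𝕜 := ℝ) (f s) (S.tangent i s)
  rw [hs, mul_one] at this
  rwa [h, norm_smul, hs, mul_one]

theorem tangential_idem (i : Fin N) (f : L2 (S.L i)) :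
    S.tangential i (S.tangential i f) = S.tangential i f := by
  ext1
  filter_upwards [S.coeFn_tangential i f, S.coeFn_tangential i (S.tangential i f),
    S.ae_norm_tangent i] with s h h' hs
  rw [h', h, real_inner_smul_left, real_inner_self_eq_norm_sq, hs]
  simp

theorem norm_sq_tangential (i : Fin N) (f : L2 (S.L i)) :
    ‖S.tangential i f‖ ^ 2 = ∫ s in Ioo 0 (S.L i), |inner ℝ (f s) (S.tangent i s)| ^ 2 := by
  rw [← real_inner_self_eq_norm_sq, L2.inner_def]
  refine integral_congr_ae ?_
  filter_upwards [S.coeFn_tangential i f, S.ae_norm_tangent i] with s h hs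
  rw [h, real_inner_self_eq_norm_sq, norm_smul, hs, mul_one, Real.norm_eq_abs]

theorem ae_inner_tangent_eq_zero {i : Fin N} {f : L2 (S.L i)} (hf : S.tangential i f = 0) :
    ∀ᵐ s ∂(intervalMeasure (S.L i)), inner ℝ (f s) (S.tangent i s) = 0 := by
  have h0 := S.coeFn_tangential i f
  rw [hf] at h0
  filter_upwards [h0, Lp.coeFn_zero E3 2 (intervalMeasure (S.L i)), S.ae_norm_tangent i]
    with s h h' hs
  rw [h', Pi.zero_apply, eq_comm, smul_eq_zero] at h
  refine h.resolve_right fun h => ?_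
  rw [h, norm_zero] at hs
  exact zero_ne_one hs

/-! ### The Hilbert space of derivatives -/

/-- The Hilbert sum of the spaces `L²(0, L i; ℝ³)`, in which the derivatives live. -/
abbrev L2Sum : Type := PiLp 2 (fun i => L2 (S.L i))

/-- The derivative `U ↦ (dU_i/ds_i)_i`. -/
noncomputable def derivSum : S.Pairs →ₗ[ℝ] S.L2Sum where
  toFun U := WithLp.toLp 2 (S.der U)
  map_add' _ _ := rfl
  map_smul' _ _ := rfl

/-- The projection `g ↦ ((g_i · T_i) T_i)_i` onto the tangential fields. -/
noncomputable def tangentialSum : S.L2Sum →ₗ[ℝ] S.L2Sum where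
  toFun g := WithLp.toLp 2 fun i => S.tangential i (g i)
  map_add' f g := by ext1 i; exact map_add (S.tangential i) (f i) (g i)
  map_smul' a f := by ext1 i; exact map_smul (S.tangential i) a (f i)

theorem ip_eq_inner (U V : S.Pairs) : S.ip U V = inner ℝ (S.derivSum U) (S.derivSum V) :=
  (S.ip_eq U V).trans (PiLp.inner_apply (𝕜 := ℝ) (S.derivSum U) (S.derivSum V)).symm

theorem clampedNorm_eq_norm (U : S.Pairs) : S.clampedNorm U = ‖S.derivSum U‖ := by
  rw [clampedNorm, ip_eq_inner, ← norm_eq_sqrt_real_inner]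

theorem normE_eq_norm (U : S.Pairs) : S.normE U = ‖S.tangentialSum (S.derivSum U)‖ := by
  rw [PiLp.norm_eq_of_L2, normE]
  congr 1
  exact Finset.sum_congr rfl fun i _ => (S.norm_sq_tangential i (S.der U i)).symm

theorem norm_tangentialSum_le (g : S.L2Sum) : ‖S.tangentialSum g‖ ≤ ‖g‖ := by
  rw [PiLp.norm_eq_of_L2, PiLp.norm_eq_of_L2]
  exact Real.sqrt_le_sqrt (Finset.sum_le_sum fun i _ =>
    pow_le_pow_left₀ (norm_nonneg _) (S.norm_tangential_le i (g i)) 2)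

theorem tangentialSum_idem (g : S.L2Sum) :
    S.tangentialSum (S.tangentialSum g) = S.tangentialSum g := by
  ext1 i; exact S.tangential_idem i (g i)

/-! ### The Poincaré inequality -/

theorem norm_primitive_le_norm (g : S.L2Sum) (i : Fin N) (s : Icc 0 (S.L i)) :
    ‖primitive (S.L_pos i).le (g i) s‖ ≤ (∑ j, √(S.L j)) * ‖g‖ :=
  (norm_primitive_le _ _ s).trans <| mul_le_mul
    (Finset.single_le_sum (f := fun j => √(S.L j)) (fun _ _ => Real.sqrt_nonneg _)
      (Finset.mem_univ i))
    (PiLp.norm_apply_le g i) (norm_nonneg _) (Finset.sum_nonneg fun _ _ => Real.sqrt_nonneg _)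

theorem norm_val_sub_le {U : S.Pairs} (hU : U ∈ S.H1) (i : Fin N) (s t : Icc 0 (S.L i)) :
    ‖S.val U i s - S.val U i t‖ ≤ 2 * (∑ j, √(S.L j)) * ‖S.derivSum U‖ := by
  rw [(hU.1 i).eq_add_primitive (S.L_pos i) s, (hU.1 i).eq_add_primitive (S.L_pos i) t,
    add_sub_add_left_eq_sub]
  have h1 := S.norm_primitive_le_norm (S.derivSum U) i s
  have h2 := S.norm_primitive_le_norm (S.derivSum U) i t
  refine (norm_sub_le _ _).trans ?_
  calc _ ≤ _ := add_le_add h1 h2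
    _ = _ := by ring

theorem isCompact_arc (i : Fin N) : IsCompact (S.φ i '' Icc 0 (S.L i)) :=
  isCompact_Icc.image_of_continuousOn (S.contDiffOn i).continuousOn

/-- The Poincaré inequality in the supremum norm. The arcs on which it holds with some constant
form a set that is closed under passing to a neighbouring arc, and contains an arc that meets
`Γ₀`; as the skeleton is connected, all arcs belong to it. -/
theorem exists_norm_val_le {Γ₀ : Set E3} (hne : Γ₀.Nonempty) (hends : Γ₀ ⊆ S.ends) :
    ∃ C, 0 ≤ C ∧ ∀ U ∈ S.H1Clamped Γ₀, ∀ i s, ‖S.val U i s‖ ≤ C * ‖S.derivSum U‖ := by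
  set A : Set (Fin N) :=
    {i | ∃ C, 0 ≤ C ∧ ∀ U ∈ S.H1Clamped Γ₀, ∀ s, ‖S.val U i s‖ ≤ C * ‖S.derivSum U‖}
  -- a bound at one point of an arc gives a bound on the whole arc
  have hpt : ∀ i (t : Icc 0 (S.L i)) (C : ℝ), 0 ≤ C →
      (∀ U ∈ S.H1Clamped Γ₀, ‖S.val U i t‖ ≤ C * ‖S.derivSum U‖) → i ∈ A := by
    intro i t C hC h
    refine ⟨C + 2 * ∑ j, √(S.L j), by positivity, fun U hU s => ?_⟩
    have h1 := h U hU
    have h2 := S.norm_val_sub_le hU.1 i s t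
    have h3 := norm_le_norm_add_norm_sub' (S.val U i s) (S.val U i t)
    rw [add_mul]
    linarith
  obtain ⟨x, hx⟩ := hne
  obtain ⟨i₀, hi₀⟩ : A.Nonempty := by
    obtain ⟨i, hi⟩ := hends hx
    obtain ⟨t, ht⟩ : ∃ t : Icc 0 (S.L i), S.φ i t = x := by
      rcases hi with hi | hi
      · exact ⟨⟨0, left_mem_Icc.2 (S.L_pos i).le⟩, hi.symm⟩
      · exact ⟨⟨S.L i, right_mem_Icc.2 (S.L_pos i).le⟩, hi.symm⟩
    refine ⟨i, hpt i t 0 le_rfl fun U hU => ?_⟩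
    rw [hU.2 i t (ht ▸ hx), norm_zero, zero_mul]
  have hall : ∀ i, i ∈ A := by
    by_contra! hcon
    obtain ⟨j₀, hj₀⟩ := hcon
    have hcl : ∀ B : Set (Fin N), IsClosed (⋃ i ∈ B, S.φ i '' Icc 0 (S.L i)) := fun B =>
      B.toFinite.isClosed_biUnion fun i _ => (S.isCompact_arc i).isClosed
    have hsub : ∀ {B : Set (Fin N)} {i}, i ∈ B →
        ((⋃ i, S.φ i '' Icc 0 (S.L i)) ∩ ⋃ i ∈ B, S.φ i '' Icc 0 (S.L i)).Nonempty :=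
      fun {B i} hi => by
        have h0 : S.φ i 0 ∈ S.φ i '' Icc 0 (S.L i) :=
          mem_image_of_mem _ (left_mem_Icc.2 (S.L_pos i).le)
        exact ⟨S.φ i 0, mem_iUnion.2 ⟨i, h0⟩, mem_biUnion hi h0⟩
    obtain ⟨y, -, hy1, hy2⟩ := isPreconnected_closed_iff.1 S.connected.isPreconnected
      _ _ (hcl A) (hcl Aᶜ) (by
        refine iUnion_subset fun i => ?_
        by_cases hi : i ∈ A
        · exact (subset_biUnion_of_mem (u := fun i => S.φ i '' Icc 0 (S.L i)) hi).trans
            subset_union_left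
        · exact (subset_biUnion_of_mem (s := Aᶜ) (u := fun i => S.φ i '' Icc 0 (S.L i)) hi).trans
            subset_union_right) (hsub hi₀) (hsub (B := Aᶜ) hj₀)
    obtain ⟨i, hi, s, hs, hsy⟩ := mem_iUnion₂.1 hy1
    obtain ⟨j, hj, t, ht, hty⟩ := mem_iUnion₂.1 hy2
    obtain ⟨C, hC0, hC⟩ := hi
    refine hj (hpt j ⟨t, ht⟩ C hC0 fun U hU => ?_)
    rw [← hU.1.2 i j ⟨s, hs⟩ ⟨t, ht⟩ (hsy.trans hty.symm)]
    exact hC U hU _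
  choose C hC0 hC using hall
  refine ⟨∑ i, C i, Finset.sum_nonneg fun i _ => hC0 i, fun U hU i s => (hC i U hU s).trans ?_⟩
  exact mul_le_mul_of_nonneg_right
    (Finset.single_le_sum (fun i _ => hC0 i) (Finset.mem_univ i)) (norm_nonneg _)

theorem h1Norm_eq (U : S.Pairs) : S.h1Norm U =
    √((∑ i, ∫ s in Ioo 0 (S.L i), ‖IccExtend (S.L_pos i).le (S.val U i) s‖ ^ 2)
      + ‖S.derivSum U‖ ^ 2) := by
  rw [h1Norm, PiLp.norm_sq_eq_of_L2, ← Finset.sum_add_distrib]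
  congr 1
  refine Finset.sum_congr rfl fun i _ => ?_
  have hc : Continuous (IccExtend (S.L_pos i).le (S.val U i)) :=
    (S.val U i).continuous.Icc_extend'
  have h1 : Integrable (fun s => ‖IccExtend (S.L_pos i).le (S.val U i) s‖ ^ 2)
      (intervalMeasure (S.L i)) :=
    (((hc.norm.pow 2).continuousOn (s := Icc 0 (S.L i))).integrableOn_Icc).mono_set
      Ioo_subset_Icc_self
  rw [integral_add h1 (Lp.memLp (S.der U i)).integrable_norm_pow']
  congr 1
  rw [← real_inner_self_eq_norm_sq, L2.inner_def]
  simp only [real_inner_self_eq_norm_sq]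
  rfl

theorem clampedNorm_le_h1Norm (U : S.Pairs) : S.clampedNorm U ≤ S.h1Norm U := by
  rw [clampedNorm_eq_norm, h1Norm_eq]
  refine Real.le_sqrt_of_sq_le (le_add_of_nonneg_left ?_)
  exact Finset.sum_nonneg fun i _ => integral_nonneg fun s => by positivity

/-- The Poincaré inequality: on `H¹_{Γ₀}(S; ℝ³)` the usual norm is controlled by the norm of the
derivative. -/
theorem exists_h1Norm_le {Γ₀ : Set E3} (hne : Γ₀.Nonempty) (hends : Γ₀ ⊆ S.ends) :
    ∃ K, 0 < K ∧ ∀ U ∈ S.H1Clamped Γ₀, S.h1Norm U ≤ K * S.clampedNorm U := by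
  obtain ⟨C, hC0, hC⟩ := S.exists_norm_val_le hne hends
  have hL : 0 ≤ ∑ i, S.L i := Finset.sum_nonneg fun i _ => (S.L_pos i).le
  refine ⟨√((∑ i, S.L i) * C ^ 2 + 1), by positivity, fun U hU => ?_⟩
  rw [clampedNorm_eq_norm, h1Norm_eq]
  refine Real.sqrt_le_iff.2 ⟨by positivity, ?_⟩
  rw [mul_pow, Real.sq_sqrt (by positivity), add_mul, one_mul, Finset.sum_mul, Finset.sum_mul]
  refine add_le_add_left (Finset.sum_le_sum fun i _ => ?_) _
  have h1 : ‖∫ s in Ioo 0 (S.L i), ‖IccExtend (S.L_pos i).le (S.val U i) s‖ ^ 2‖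
      ≤ (C * ‖S.derivSum U‖) ^ 2 * (volume : Measure ℝ).real (Ioo 0 (S.L i)) :=
    norm_setIntegral_le_of_norm_le_const (by simp) fun s _ => by
      rw [norm_pow, norm_norm]
      exact pow_le_pow_left₀ (norm_nonneg _) (hC U hU i _) 2
  rw [Real.volume_real_Ioo_of_le (S.L_pos i).le, sub_zero] at h1
  refine (le_abs_self _).trans (h1.trans_eq ?_)
  ring

end Skeleton

/-! ### Bounded lifting of tangential derivatives -/

/-- A linear map into a finite-dimensional space has a section over its range that is bounded for
any seminorm of the form `x ↦ ‖D x‖`. -/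
theorem exists_apply_eq_norm_le {X Y W : Type*} [AddCommGroup X] [Module ℝ X]
    [NormedAddCommGroup Y] [NormedSpace ℝ Y] [NormedAddCommGroup W] [NormedSpace ℝ W]
    [FiniteDimensional ℝ W] (q : X →ₗ[ℝ] W) (D : X →ₗ[ℝ] Y) :
    ∃ K, 0 ≤ K ∧ ∀ x, ∃ x', q x' = q x ∧ ‖D x'‖ ≤ K * ‖q x‖ := by
  obtain ⟨τ, hτ⟩ := q.rangeRestrict.exists_rightInverse_of_surjective q.range_rangeRestrict
  refine ⟨‖LinearMap.toContinuousLinearMap (D ∘ₗ τ)‖,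
    ContinuousLinearMap.opNorm_nonneg _, fun x =>
    ⟨τ (q.rangeRestrict x), congrArg Subtype.val (LinearMap.congr_fun hτ _), ?_⟩⟩
  exact (LinearMap.toContinuousLinearMap (D ∘ₗ τ)).le_opNorm (q.rangeRestrict x)

namespace Skeleton

variable {N : ℕ} (S : Skeleton N)

/-- The nodes of the skeleton: the ends of arcs and the common points of different arcs. -/
def nodes : Set E3 :=
  S.ends ∪ ⋃ i, ⋃ j, ⋃ (_ : i ≠ j), S.φ i '' Icc 0 (S.L i) ∩ S.φ j '' Icc 0 (S.L j)

theorem finite_nodes : S.nodes.Finite := by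
  refine Finite.union ?_ (finite_iUnion fun i => finite_iUnion fun j => finite_iUnion fun h =>
    S.finite_inter i j h)
  have : S.ends = (range fun i => S.φ i 0) ∪ range fun i => S.φ i (S.L i) := by
    ext x; simp only [ends, mem_ofPred_eq, mem_union, mem_range, exists_or, eq_comm]
  rw [this]
  exact (finite_range _).union (finite_range _)

/-- The parameters on the arc `i` of the nodes. -/
def nodeParams (i : Fin N) : Set (Icc 0 (S.L i)) := {s | S.φ i s ∈ S.nodes}

theorem finite_nodeParams (i : Fin N) : (S.nodeParams i).Finite := by
  refine Finite.of_finite_image (f := Subtype.val) ?_ Subtype.val_injective.injOn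
  have hinj : InjOn (S.φ i) (Ioo 0 (S.L i)) := injOn_iff_injective.2 (S.embedded i).injective
  have hfin : (Ioo 0 (S.L i) ∩ S.φ i ⁻¹' S.nodes).Finite :=
    (S.finite_nodes.subset (by rintro _ ⟨s, hs, rfl⟩; exact hs.2)).of_finite_image
      (f := S.φ i) (hinj.mono inter_subset_left)
  refine (hfin.union (toFinite {0, S.L i})).subset ?_
  rintro _ ⟨s, hs, rfl⟩
  rcases s.2.1.eq_or_lt with h0 | h0
  · exact Or.inr (Or.inl h0.symm)
  rcases s.2.2.eq_or_lt with h1 | h1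
  · exact Or.inr (Or.inr h1)
  · exact Or.inl ⟨⟨h0, h1⟩, hs⟩

instance (i : Fin N) : Finite (S.nodeParams i) := (S.finite_nodeParams i).to_subtype

/-- Two parameters of one point of the skeleton either coincide or both belong to a node. -/
theorem mem_nodeParams_of_eq {i j : Fin N} {s : Icc 0 (S.L i)} {t : Icc 0 (S.L j)}
    (h : S.φ i s = S.φ j t) :
    (s ∈ S.nodeParams i ∧ t ∈ S.nodeParams j) ∨ ∃ e : i = j, e ▸ s = t := by
  have key : ∀ x, x = S.φ i s → x = S.φ j t → x ∈ S.nodes →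
      s ∈ S.nodeParams i ∧ t ∈ S.nodeParams j := by
    rintro x h1 h2 hx
    exact ⟨show S.φ i s ∈ S.nodes from h1 ▸ hx, show S.φ j t ∈ S.nodes from h2 ▸ hx⟩
  by_cases e : i = j
  · subst e
    by_cases hst : s = t
    · exact Or.inr ⟨rfl, hst⟩
    refine Or.inl (key _ rfl h ?_)
    rcases s.2.1.eq_or_lt with h0 | h0
    · exact Or.inl ⟨i, Or.inl (by rw [← h0])⟩
    rcases s.2.2.eq_or_lt with h1 | h1
    · exact Or.inl ⟨i, Or.inr (by rw [h1])⟩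
    rcases t.2.1.eq_or_lt with h2 | h2
    · exact Or.inl ⟨i, Or.inl (by rw [h, ← h2])⟩
    rcases t.2.2.eq_or_lt with h3 | h3
    · exact Or.inl ⟨i, Or.inr (by rw [h, h3])⟩
    have hinj : InjOn (S.φ i) (Ioo 0 (S.L i)) := injOn_iff_injective.2 (S.embedded i).injective
    exact absurd (Subtype.ext (hinj ⟨h0, h1⟩ ⟨h2, h3⟩ h)) hst
  · refine Or.inl (key _ rfl h (Or.inr ?_))
    simp only [mem_iUnion]
    exact ⟨i, j, e, mem_image_of_mem _ s.2, h ▸ mem_image_of_mem _ t.2⟩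

/-- The values at the nodes of the arcwise primitives of a family of `L²` functions. -/
noncomputable def nodeValues : S.L2Sum →ₗ[ℝ] ∀ i, S.nodeParams i → E3 where
  toFun g i p := primitive (S.L_pos i).le (g i) p
  map_add' f g := by
    ext1 i; ext1 p
    exact DFunLike.congr_fun (map_add (primitive (S.L_pos i).le) (f i) (g i)) p.1
  map_smul' a f := by
    ext1 i; ext1 p
    exact DFunLike.congr_fun (map_smul (primitive (S.L_pos i).le) a (f i)) p.1

/-- A family of `L²` functions whose primitives vanish at all nodes is the derivative of a
displacement of the skeleton. -/
theorem exists_deriv_eq {Γ₀ : Set E3} (hends : Γ₀ ⊆ S.ends) {g : S.L2Sum}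
    (hg : S.nodeValues g = 0) : ∃ V ∈ S.H1Clamped Γ₀, S.derivSum V = g := by
  have h0 : ∀ i, ∀ s ∈ S.nodeParams i, primitive (S.L_pos i).le (g i) s = 0 := fun i s hs =>
    congrFun (congrFun hg i) ⟨s, hs⟩
  refine ⟨fun i => (primitive (S.L_pos i).le (g i), g i),
    ⟨⟨fun i => isWeakDeriv_primitive _ _, fun i j s t h => ?_⟩,
      fun i s hs => h0 i s (Or.inl (hends hs))⟩, rfl⟩
  rcases S.mem_nodeParams_of_eq h with ⟨hs, ht⟩ | ⟨rfl, rfl⟩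
  · exact (h0 i s hs).trans (h0 j t ht).symm
  · rfl

/-- Every tangential derivative of a displacement is attained by a displacement whose full
derivative it controls. The arcwise primitive of the tangential derivative would do, but for its
node values; these are first corrected by a displacement from a finite-dimensional space. -/
theorem exists_bounded_lift {Γ₀ : Set E3} (hends : Γ₀ ⊆ S.ends) :
    ∃ K, 0 < K ∧ ∀ U ∈ S.H1Clamped Γ₀, ∃ V ∈ S.H1Clamped Γ₀,
      S.tangentialSum (S.derivSum V) = S.tangentialSum (S.derivSum U) ∧
        ‖S.derivSum V‖ ≤ K * ‖S.tangentialSum (S.derivSum U)‖ := by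
  have _ : ∀ i, Fintype (S.nodeParams i) := fun i => Fintype.ofFinite _
  obtain ⟨M, hM, hsec⟩ := exists_apply_eq_norm_le (X := S.H1Clamped Γ₀)
    (S.nodeValues ∘ₗ S.tangentialSum ∘ₗ S.derivSum ∘ₗ (S.H1Clamped Γ₀).subtype)
    (S.derivSum ∘ₗ (S.H1Clamped Γ₀).subtype)
  set R := ∑ j, √(S.L j)
  have hR0 : 0 ≤ R := Finset.sum_nonneg fun _ _ => Real.sqrt_nonneg _
  refine ⟨2 * (M * R) + 1, by positivity, fun U hU => ?_⟩
  obtain ⟨⟨V₁, hV₁⟩, hq, hD⟩ := hsec ⟨U, hU⟩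
  simp only [LinearMap.comp_apply, Submodule.subtype_apply] at hq hD
  set g := S.tangentialSum (S.derivSum U) with hg
  have hgn : ‖S.nodeValues g‖ ≤ R * ‖g‖ :=
    (pi_norm_le_iff_of_nonneg (by positivity)).2 fun i =>
      (pi_norm_le_iff_of_nonneg (by positivity)).2 fun p => S.norm_primitive_le_norm g i p
  have hDg : ‖S.derivSum V₁‖ ≤ M * R * ‖g‖ := by
    rw [mul_assoc]
    exact hD.trans (mul_le_mul_of_nonneg_left hgn hM)
  -- the tangential derivatives of `V₁` and `U` have primitives with the same node values, so the
  -- primitives of the difference vanish at the nodes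
  obtain ⟨V₂, hV₂, hVg⟩ := S.exists_deriv_eq hends
    (g := g - S.tangentialSum (S.derivSum V₁)) (by rw [map_sub, hq, sub_self])
  refine ⟨V₁ + V₂, add_mem hV₁ hV₂, ?_, ?_⟩
  · rw [map_add, map_add, hVg, map_sub, tangentialSum_idem, hg, tangentialSum_idem,
      add_sub_cancel]
  · rw [map_add, hVg]
    have h1 := norm_add_le (S.derivSum V₁) (g - S.tangentialSum (S.derivSum V₁))
    have h2 := norm_sub_le g (S.tangentialSum (S.derivSum V₁))
    have h3 := S.norm_tangentialSum_le (S.derivSum V₁)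
    linarith

/-- On extensional displacements the norm is controlled by the tangential derivative: if `V`
lifts the tangential derivative of `U`, then `U - V` is inextensional, hence
`‖U‖² = ⟨U, V⟩ ≤ ‖U‖ ‖V‖`. -/
theorem exists_clampedNorm_le_normE {Γ₀ : Set E3} (hends : Γ₀ ⊆ S.ends) :
    ∃ K, 0 < K ∧ ∀ U ∈ S.DE Γ₀, S.clampedNorm U ≤ K * S.normE U := by
  obtain ⟨K, hK, h⟩ := S.exists_bounded_lift hends
  refine ⟨K, hK, fun U hU => ?_⟩
  obtain ⟨V, hV, hVU, hle⟩ := h U hU.1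
  rw [clampedNorm_eq_norm, normE_eq_norm]
  refine le_trans ?_ hle
  have hDI : U - V ∈ S.DI Γ₀ := by
    refine ⟨sub_mem hU.1 hV, fun i => S.ae_inner_tangent_eq_zero ?_⟩
    have : S.tangentialSum (S.derivSum (U - V)) = 0 := by rw [map_sub, map_sub, hVU, sub_self]
    exact congrArg (fun g : S.L2Sum => g i) this
  have h0 := hU.2 _ hDI
  rw [ip_eq_inner, map_sub, inner_sub_right, sub_eq_zero, real_inner_self_eq_norm_sq] at h0
  have h1 := real_inner_le_norm (S.derivSum U) (S.derivSum V)
  rw [← h0, sq] at h1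
  rcases (norm_nonneg (S.derivSum U)).eq_or_lt with h2 | h2
  · rw [← h2]; exact norm_nonneg _
  · exact le_of_mul_le_mul_left h1 h2

theorem normE_le_clampedNorm (U : S.Pairs) : S.normE U ≤ S.clampedNorm U := by
  rw [clampedNorm_eq_norm, normE_eq_norm]
  exact S.norm_tangentialSum_le _

theorem eq_zero_of_clampedNorm_eq_zero {Γ₀ : Set E3} (hne : Γ₀.Nonempty) (hends : Γ₀ ⊆ S.ends)
    {U : S.Pairs} (hU : U ∈ S.H1Clamped Γ₀) (h : S.clampedNorm U = 0) : U = 0 := by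
  obtain ⟨C, -, hC⟩ := S.exists_norm_val_le hne hends
  rw [clampedNorm_eq_norm] at h
  ext1 i
  refine Prod.ext (ContinuousMap.ext fun s => ?_) ?_
  · have := hC U hU i s
    rw [h, mul_zero] at this
    exact norm_le_zero_iff.1 this
  · exact congrArg (fun g : S.L2Sum => g i) (norm_eq_zero.1 h)

end Skeleton
end RodSkeleton

theorem lemma4p3 {N : ℕ} (S : RodSkeleton.Skeleton N) (Γ₀ : Set RodSkeleton.E3)
    (hne : Γ₀.Nonempty) (hends : Γ₀ ⊆ S.ends) :
    -- the seminorm is a norm on the space of extensional displacements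
    ((∀ U ∈ S.DE Γ₀, ∀ V ∈ S.DE Γ₀, S.normE (U + V) ≤ S.normE U + S.normE V) ∧
      (∀ a : ℝ, ∀ U ∈ S.DE Γ₀, S.normE (a • U) = |a| * S.normE U) ∧
      (∀ U ∈ S.DE Γ₀, S.normE U = 0 → U = 0)) ∧
    -- it is equivalent there to the norm given by the inner product of the clamped space
    (∃ c C : ℝ, 0 < c ∧ 0 < C ∧ ∀ U ∈ S.DE Γ₀,
      c * S.clampedNorm U ≤ S.normE U ∧ S.normE U ≤ C * S.clampedNorm U) ∧
    -- and to the usual first order Sobolev norm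
    (∃ c C : ℝ, 0 < c ∧ 0 < C ∧ ∀ U ∈ S.DE Γ₀,
      c * S.h1Norm U ≤ S.normE U ∧ S.normE U ≤ C * S.h1Norm U) := by
  obtain ⟨K, hK, h⟩ := S.exists_clampedNorm_le_normE hends
  obtain ⟨M, hM, hP⟩ := S.exists_h1Norm_le hne hends
  refine ⟨⟨fun U _ V _ => ?_, fun a U _ => ?_, fun U hU h0 => ?_⟩,
    ⟨K⁻¹, 1, inv_pos.2 hK, one_pos, fun U hU => ⟨?_, ?_⟩⟩,
    ⟨(M * K)⁻¹, 1, inv_pos.2 (mul_pos hM hK), one_pos, fun U hU => ⟨?_, ?_⟩⟩⟩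
  · simp only [S.normE_eq_norm, map_add]
    exact norm_add_le _ _
  · simp only [S.normE_eq_norm, map_smul, norm_smul, Real.norm_eq_abs]
  · refine S.eq_zero_of_clampedNorm_eq_zero hne hends hU.1 (le_antisymm ?_ (Real.sqrt_nonneg _))
    simpa [h0] using h U hU
  · exact (inv_mul_le_iff₀ hK).2 (h U hU)
  · rw [one_mul]
    exact S.normE_le_clampedNorm U
  · rw [inv_mul_le_iff₀ (mul_pos hM hK), mul_assoc]
    exact (hP U hU.1).trans (mul_le_mul_of_nonneg_left (h U hU) hM.le)
  · rw [one_mul]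
    exact (S.normE_le_clampedNorm U).trans (S.clampedNorm_le_h1Norm U)
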